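/- Let $n_0\ge 1$. Call a compact set $K\subset\mathbb C$ admissible if $\mathbb C\setminus K$ is connected and $K$ has exactly $n_0+1$ connected components $K_0,\dots,K_{n_0}$, each containing more than one point. A test function for $K$ is a function $F:K\to\mathbb C$ of the form $F=p_j$ on $K_j$ $(0\le j\le n_0)$, where $p_0,\dots,p_{n_0}$ are pairwise different complex polynomials. Let $V_n$ be the space of complex polynomials of degree at most $n$, let $d(V_n,F)=\min_{p\in V_n}\sup_{z\in K}|F(z)-p(z)|$, and let $$\rho_K=\limsup_{n\to\infty} d(V_n,F)^{1/n}$$ be the asymptotic convergence factor of $K$. (It is well known not to depend on the test function $F$; the assertions below are meant for $\rho_K$ computed with any test function.) Put $$B(K)=\max_{0\le i\le n_0}\ \sup_{z\in \operatorname{int}K_i}\frac{\operatorname{dist}(z,\mathbb C\setminus K_i)}{\operatorname{dist}(z,K\setminus K_i)},$$ where the supremum over an empty set is $0$. Then: 1. For every admissible $K$, $\ \rho_K\ge B(K)$. 2. This bound is optimal in the following sense: for all $c\in\mathbb C$, $0<r<d$ and $\varepsilon>0$ there is an admissible $K$ whose component $K_0$ is the closed disc with centre $c$ and radius $r$, with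 $\operatorname{dist}(c,K\setminus K_0)=d$ and $B(K)=r/d$, such that $\rho_K<r/d+\varepsilon$. (Here $K$ does not depend on the test function.) In particular, for every $q\in(0,1)$ the infimum of $\rho_K$ over all admissible $K$ with $B(K)=q$ is equal to $q$. -/

import Mathlib

open scoped ENNReal

noncomputable section

/-- `K` is a compact plane set with connected complement whose connected components are exactly
the `n₀ + 1` distinct sets `C 0, …, C n₀`, each of them containing more than one point. -/
structure IsAdmissible {n₀ : ℕ} (K : Set ℂ) (C : Fin (n₀ + 1) → Set ℂ) : Prop where
  isCompact : IsCompact K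
  isConnected_compl : IsConnected Kᶜ
  injective : Function.Injective C
  range_eq : Set.range C = {S | ∃ z ∈ K, S = connectedComponentIn K z}
  nontrivial : ∀ i, (C i).Nontrivial

/-- On each `C j` the function `F` coincides with a complex polynomial `p j`, and the polynomials
`p 0, …, p n₀` are pairwise different. Only the values of `F` on the union of the `C j` matter. -/
def IsPiecewisePolynomial {n₀ : ℕ} (C : Fin (n₀ + 1) → Set ℂ) (F : ℂ → ℂ) : Prop :=
  ∃ p : Fin (n₀ + 1) → Polynomial ℂ, Function.Injective p ∧
    ∀ j, ∀ z ∈ C j, F z = (p j).eval z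

/-- The supremum norm `‖f‖_A ∈ [0, ∞]`. -/
def supNorm (A : Set ℂ) (f : ℂ → ℂ) : ℝ≥0∞ :=
  ⨆ z ∈ A, ‖f z‖ₑ

/-- `d(V_n, F)`: the distance, in the supremum norm on `K`, from `F` to the space `V_n` of complex
polynomials of degree at most `n`. -/
def polyDist (K : Set ℂ) (F : ℂ → ℂ) (n : ℕ) : ℝ≥0∞ :=
  ⨅ p ∈ Polynomial.degreeLE ℂ (n : WithBot ℕ), supNorm K (fun z => F z - p.eval z)

/-- The asymptotic convergence factor `limsup_{n → ∞} d(V_n, F)^{1/n}` of `K`, computed with the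
test function `F`. -/
def asymptoticConvergenceFactor (K : Set ℂ) (F : ℂ → ℂ) : ℝ≥0∞ :=
  Filter.limsup (fun n : ℕ => polyDist K F n ^ ((1 : ℝ) / n)) Filter.atTop

/-- `max_i sup_{z ∈ int (C i)} dist(z, (C i)ᶜ) / dist(z, K \ C i)`. A supremum over the empty
set is `0`. -/
def geometricLowerBound {n₀ : ℕ} (K : Set ℂ) (C : Fin (n₀ + 1) → Set ℂ) : ℝ≥0∞ :=
  ⨆ i, ⨆ z ∈ interior (C i), Metric.infEDist z (C i)ᶜ / Metric.infEDist z (K \ C i)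

end

/-! Lower bound. If the factor were below some `R` smaller than the quotient at an interior point
`z` of `C i`, there would be polynomials `P n` of degree at most `n` with error at most `R ^ n` on
`K`, and a disc of radius `s` about `z` inside `C i` whose dilation by `1 / R` reaches a point `w`
of another component. The Bernstein–Walsh inequality for discs (`norm_eval_le_of_forall_sphere`)
lets `P n - p i` grow only by `(A / s) ^ n` out to radius `A < s / R`, so `P n` tends to `p i` near
`w`. There it also tends to `p j`, which forces `p i = p j`.

Sharpness. `K` is a disc together with tiny segments on a ray from its centre. The task reduces to
polynomials that are close to `0` on the disc and to Kronecker deltas on the segments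
(`exists_separating_polynomials`). They are products of two Hermite interpolants of a step from `0`
to `1`: one in `z / v j`, vanishing at `0` to a much higher order than its order of contact at `1`,
which gives a rate near `r / d` on the disc; the other in a Lagrange basis polynomial, which tells
the segments apart at a bounded cost in degree. The segments are shortened last, so that the errors
on them meet the same rate. -/

/-! ### Hermite interpolation of a step from `0` to `1`. -/

/-- The geometric-type series need not converge at `s`. For `k < m` one has `s ^ k ≤ (s / t) ^ m * t
^ k`, and the series at `t` sums to `1 / (1 - t) ^ (n + 1)`. -/
theorem sum_choose_mul_pow_le {s t : ℝ} (ht : 0 < t) (ht1 : t < 1) (hts : t ≤ s) (n m : ℕ) :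
    ∑ k ∈ Finset.range m, ((k + n).choose n : ℝ) * s ^ k ≤ (s / t) ^ m / (1 - t) ^ (n + 1) := by
  have hS := hasSum_choose_mul_geometric_of_norm_lt_one (𝕜 := ℝ) n (r := t)
    (by rwa [Real.norm_of_nonneg ht.le])
  have h1 : 1 ≤ s / t := (one_le_div ht).2 hts
  calc ∑ k ∈ Finset.range m, ((k + n).choose n : ℝ) * s ^ k
      ≤ ∑ k ∈ Finset.range m, (s / t) ^ m * (((k + n).choose n : ℝ) * t ^ k) := by
        refine Finset.sum_le_sum fun k hk => ?_
        have h2 : s ^ k = (s / t) ^ k * t ^ k := by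
          rw [← mul_pow, div_mul_cancel₀ _ ht.ne']
        have h3 : (s / t) ^ k ≤ (s / t) ^ m :=
          pow_le_pow_right₀ h1 (Finset.mem_range.1 hk).le
        calc ((k + n).choose n : ℝ) * s ^ k
            = (s / t) ^ k * (((k + n).choose n : ℝ) * t ^ k) := by rw [h2]; ring
          _ ≤ _ := by gcongr
    _ = (s / t) ^ m * ∑ k ∈ Finset.range m, ((k + n).choose n : ℝ) * t ^ k := by
        rw [Finset.mul_sum]
    _ ≤ (s / t) ^ m * (1 / (1 - t) ^ (n + 1)) := by
        gcongr
        exact sum_le_hasSum _ (fun k _ => by positivity) hS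
    _ = _ := by ring

/-- The same comparison with `t`, now for the Taylor tail: for `k ≥ m` and `s ≤ t` the factor `(s /
t) ^ k` is at most `(s / t) ^ m`. -/
theorem norm_inv_pow_sub_sum_choose_le {s t : ℝ} (ht : 0 < t) (ht1 : t < 1) (hst : s ≤ t) {y : ℂ}
    (hy : ‖y‖ ≤ s) (n m : ℕ) :
    ‖1 / (1 - y) ^ (n + 1) - ∑ k ∈ Finset.range m, ((k + n).choose n : ℂ) * y ^ k‖ ≤
      (s / t) ^ m / (1 - t) ^ (n + 1) := by
  have hs : 0 ≤ s := (norm_nonneg _).trans hy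
  have hS := hasSum_choose_mul_geometric_of_norm_lt_one (𝕜 := ℝ) n (r := t)
    (by rwa [Real.norm_of_nonneg ht.le])
  have hY := hasSum_choose_mul_geometric_of_norm_lt_one (𝕜 := ℂ) n (r := y)
    ((hy.trans hst).trans_lt ht1)
  have hS' := ((hasSum_nat_add_iff' m).2 hS).mul_left ((s / t) ^ m)
  have hY' := (hasSum_nat_add_iff' m).2 hY
  have hst1 : s / t ≤ 1 := (div_le_one ht).2 hst
  refine (hY'.norm_le_of_bounded hS' fun k => ?_).trans ?_
  · have h2 : s ^ (k + m) = (s / t) ^ (k + m) * t ^ (k + m) := by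
      rw [← mul_pow, div_mul_cancel₀ _ ht.ne']
    have h3 : (s / t) ^ (k + m) ≤ (s / t) ^ m :=
      pow_le_pow_of_le_one (by positivity) hst1 (by omega)
    rw [norm_mul, norm_pow, Complex.norm_natCast]
    calc ((k + m + n).choose n : ℝ) * ‖y‖ ^ (k + m)
        ≤ ((k + m + n).choose n : ℝ) * s ^ (k + m) := by gcongr
      _ = (s / t) ^ (k + m) * (((k + m + n).choose n : ℝ) * t ^ (k + m)) := by rw [h2]; ring
      _ ≤ _ := by gcongr
  · rw [div_eq_mul_one_div ((s / t) ^ m)]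
    gcongr
    rw [sub_le_self_iff]
    exact Finset.sum_nonneg fun k _ => by positivity

/-- The polynomial of degree at most `n + m` that vanishes to order `n + 1` at `0` and agrees with
`1` to order `m` at `1`. -/
noncomputable def hermiteStep (n m : ℕ) : Polynomial ℂ :=
  Polynomial.X ^ (n + 1) *
    ∑ k ∈ Finset.range m, Polynomial.C ((k + n).choose n : ℂ) * (1 - Polynomial.X) ^ k

theorem eval_hermiteStep (n m : ℕ) (x : ℂ) :
    (hermiteStep n m).eval x =
      x ^ (n + 1) * ∑ k ∈ Finset.range m, ((k + n).choose n : ℂ) * (1 - x) ^ k := by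
  simp [hermiteStep, Polynomial.eval_finsetSum]

theorem natDegree_hermiteStep_le (n m : ℕ) : (hermiteStep n m).natDegree ≤ n + 1 + m := by
  refine Polynomial.natDegree_mul_le.trans (add_le_add (Polynomial.natDegree_X_pow_le _) ?_)
  refine Polynomial.natDegree_sum_le_of_forall_le _ _ fun k hk => ?_
  refine (Polynomial.natDegree_C_mul_le _ _).trans (Polynomial.natDegree_pow_le.trans ?_)
  have h : (1 - Polynomial.X : Polynomial ℂ).natDegree ≤ 1 :=
    (Polynomial.natDegree_sub_le _ _).trans (by simp)
  have := Finset.mem_range.1 hk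
  nlinarith

theorem norm_eval_hermiteStep_le {s t : ℝ} (ht : 0 < t) (ht1 : t < 1) (hts : t ≤ s) {x : ℂ}
    (hx : ‖1 - x‖ ≤ s) (n m : ℕ) :
    ‖(hermiteStep n m).eval x‖ ≤ ‖x‖ ^ (n + 1) * ((s / t) ^ m / (1 - t) ^ (n + 1)) := by
  rw [eval_hermiteStep, norm_mul, norm_pow]
  gcongr
  refine le_trans ?_ (sum_choose_mul_pow_le ht ht1 hts n m)
  refine norm_sum_le_of_le _ fun k _ => ?_
  rw [norm_mul, norm_pow, Complex.norm_natCast]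
  gcongr

/-- The sum in `hermiteStep` is the Taylor polynomial of `x ^ (-(n + 1))` at `1`, so the error is `x
^ (n + 1)` times the Taylor tail. -/
theorem norm_one_sub_eval_hermiteStep_le {s t : ℝ} (ht : 0 < t) (ht1 : t < 1) (hst : s ≤ t)
    {x : ℂ} (hx : ‖1 - x‖ ≤ s) (n m : ℕ) :
    ‖1 - (hermiteStep n m).eval x‖ ≤ ‖x‖ ^ (n + 1) * ((s / t) ^ m / (1 - t) ^ (n + 1)) := by
  have hx0 : x ≠ 0 := by
    rintro rfl
    simp at hx
    linarith
  have h := norm_inv_pow_sub_sum_choose_le ht ht1 hst hx n m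
  rw [sub_sub_cancel] at h
  rw [eval_hermiteStep]
  have : 1 - x ^ (n + 1) * ∑ k ∈ Finset.range m, ((k + n).choose n : ℂ) * (1 - x) ^ k =
      x ^ (n + 1) *
        (1 / x ^ (n + 1) - ∑ k ∈ Finset.range m, ((k + n).choose n : ℂ) * (1 - x) ^ k) := by
    field_simp
  rw [this, norm_mul, norm_pow]
  gcongr

/-- With `n + 1 = l * m` the bound becomes a pure `m`-th power, so rates can be compared
independently of `m`. -/
theorem norm_eval_hermiteStep_mul_le {s t X : ℝ} (ht : 0 < t) (ht1 : t < 1) (hts : t ≤ s) {x : ℂ}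
    (hx : ‖1 - x‖ ≤ s) (hX : ‖x‖ ≤ X) {l m : ℕ} (hl : 1 ≤ l) (hm : 1 ≤ m) :
    ‖(hermiteStep (l * m - 1) m).eval x‖ ≤ (X ^ l * (s / t) / (1 - t) ^ l) ^ m := by
  have h := norm_eval_hermiteStep_le ht ht1 hts hx (l * m - 1) m
  rw [Nat.sub_add_cancel (Nat.mul_pos hl hm)] at h
  have h0 : 0 < 1 - t := by linarith
  calc _ ≤ _ := h
    _ ≤ X ^ (l * m) * ((s / t) ^ m / (1 - t) ^ (l * m)) := by
        have : 0 ≤ s / t := div_nonneg (ht.le.trans hts) ht.le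
        gcongr
    _ = _ := by rw [div_pow (X ^ l * (s / t)), mul_pow (X ^ l), ← pow_mul, ← pow_mul, mul_div_assoc]

theorem norm_one_sub_eval_hermiteStep_mul_le {s t X : ℝ} (ht : 0 < t) (ht1 : t < 1) (hst : s ≤ t)
    {x : ℂ} (hx : ‖1 - x‖ ≤ s) (hX : ‖x‖ ≤ X) {l m : ℕ} (hl : 1 ≤ l) (hm : 1 ≤ m) :
    ‖1 - (hermiteStep (l * m - 1) m).eval x‖ ≤ (X ^ l * (s / t) / (1 - t) ^ l) ^ m := by
  have h := norm_one_sub_eval_hermiteStep_le ht ht1 hst hx (l * m - 1) m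
  rw [Nat.sub_add_cancel (Nat.mul_pos hl hm)] at h
  have h0 : 0 < 1 - t := by linarith
  calc _ ≤ _ := h
    _ ≤ X ^ (l * m) * ((s / t) ^ m / (1 - t) ^ (l * m)) := by
        have : 0 ≤ s / t := div_nonneg ((norm_nonneg _).trans hx) ht.le
        gcongr
    _ = _ := by rw [div_pow (X ^ l * (s / t)), mul_pow (X ^ l), ← pow_mul, ← pow_mul, mul_div_assoc]

/-! ### Polynomials separating a disc and finitely many points. -/

theorem exists_forall_norm_eval_le {ι : Type*} [Fintype ι] (P : ι → Polynomial ℂ) (r : ℝ) :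
    ∃ R : ℝ, 1 ≤ R ∧ ∀ j z, ‖z‖ ≤ r → ‖(P j).eval z‖ ≤ R := by
  have h (j : ι) : ∃ R : ℝ, ∀ z ∈ Metric.closedBall (0 : ℂ) r, ‖(P j).eval z‖ ≤ R :=
    (isCompact_closedBall _ _).exists_bound_of_continuousOn (P j).continuous.continuousOn
  choose R hR using h
  refine ⟨1 + ∑ j, |R j|, by simpa using Finset.sum_nonneg fun j _ => abs_nonneg (R j), ?_⟩
  intro j z hz
  have h1 := hR j z (by simpa using hz)
  have h2 := Finset.single_le_sum (f := fun j => |R j|) (fun j _ => abs_nonneg (R j))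
    (Finset.mem_univ j)
  have h3 := le_abs_self (R j)
  linarith

theorem exists_pos_forall_norm_eval_sub_le {ι κ : Type*} [Finite ι] [Finite κ]
    (P : κ → Polynomial ℂ) (v : ι → ℂ) {η : ℝ} (hη : 0 < η) :
    ∃ δ > 0, ∀ i j z, ‖z - v i‖ ≤ δ → ‖(P j).eval z - (P j).eval (v i)‖ ≤ η := by
  have h (p : ι × κ) : ∃ δ > 0, ∀ z, ‖z - v p.1‖ < δ →
      ‖(P p.2).eval z - (P p.2).eval (v p.1)‖ < η := by
    have := Metric.continuous_iff.1 (P p.2).continuous (v p.1) η hη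
    simpa [dist_eq_norm] using this
  choose δ hδ h using h
  have h1 : ∀ᶠ x in nhdsWithin (0 : ℝ) (Set.Ioi 0), ∀ p, x ∈ Set.Ioo 0 (δ p) :=
    Filter.eventually_all.2 fun p => Ioo_mem_nhdsGT (hδ p)
  obtain ⟨x, hx, hx0⟩ := (h1.and self_mem_nhdsWithin).exists
  exact ⟨x, hx0, fun i j z hz => (h (i, j) z (hz.trans_lt (hx (i, j)).2)).le⟩

set_option maxHeartbeats 1000000 in
-- The order of choices matters: `t` and `l` fix the rate on the disc and hence `e`; only then is
-- `δ` shrunk, independently of `m`, to reach this rate near the points `v i`.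
theorem exists_separating_polynomials {n : ℕ} (v : Fin n → ℂ) (hv : Function.Injective v)
    {r d q : ℝ} (hr : 0 < r) (hrd : r < d) (hd : ∀ j, d ≤ ‖v j‖) (hq : r / d < q) (hq1 : q < 1) :
    ∃ e : ℕ, 0 < e ∧ ∃ δ : ℝ, 0 < δ ∧ ∃ h : ℕ → Fin n → Polynomial ℂ, ∀ m, 1 ≤ m → ∀ j,
      (h m j).natDegree ≤ e * m ∧ (∀ z, ‖z‖ ≤ r → ‖(h m j).eval z‖ ≤ q ^ (e * m)) ∧
      ∀ i z, ‖z - v i‖ ≤ δ →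
        ‖(if i = j then 1 else 0) - (h m j).eval z‖ ≤ 2 * q ^ (e * m) := by
  have hd0 : 0 < d := hr.trans hrd
  have ha0 : 0 < r / d := by positivity
  have hq0 : 0 < q := ha0.trans hq
  have hv0 (j) : 0 < ‖v j‖ := hd0.trans_le (hd j)
  set P : Fin n → Polynomial ℂ := Lagrange.basis Finset.univ v with hP
  have hPv (i j) : (P j).eval (v i) = if i = j then 1 else 0 := by
    split_ifs with hij
    · subst hij
      exact Lagrange.eval_basis_self hv.injOn (Finset.mem_univ _)
    · exact Lagrange.eval_basis_of_ne (Ne.symm hij) (Finset.mem_univ _)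
  have hPdeg (j) : (P j).natDegree ≤ n := by
    rw [hP, Lagrange.natDegree_basis hv.injOn (Finset.mem_univ _)]
    simp
  obtain ⟨R, hR1, hR⟩ := exists_forall_norm_eval_le P r
  -- The gap between `r / d` and `q` leaves room for the loss `(1 - t) ^ l` in the denominator of
  -- the Hermite bound.
  obtain ⟨t, ht0, ht1, hat⟩ : ∃ t : ℝ, 0 < t ∧ t < 1 ∧ r / d < q * (1 - t) := by
    have h1 : r / d / q < 1 := (div_lt_one hq0).2 hq
    have h2 : 0 < r / d / q := by positivity
    refine ⟨(1 - r / d / q) / 2, by linarith, by linarith, ?_⟩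
    have h3 : q * (r / d / q) = r / d := by field_simp
    nlinarith
  have ht1' : 0 < 1 - t := by linarith
  set b : ℝ := r / d / (q * (1 - t)) with hb
  have hb0 : 0 < b := by positivity
  have hb1 : b < 1 := (div_lt_one (by positivity)).2 hat
  -- `M ^ m` bounds the Lagrange factor on the disc.
  set M : ℝ := R * ((1 + R) * 4) with hM
  have hM0 : 0 < M := by positivity
  -- A large `l` absorbs everything that does not grow with it: `2 / t`, `M` and the additional
  -- degree `1 + 2 * n`.
  obtain ⟨l, hl1, hl⟩ : ∃ l : ℕ, 1 ≤ l ∧ b ^ l ≤ q ^ (1 + 2 * n) * t / (2 * M) := by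
    obtain ⟨l, hl⟩ := exists_pow_lt_of_lt_one
      (show 0 < q ^ (1 + 2 * n) * t / (2 * M) by positivity) hb1
    exact ⟨l + 1, by omega, (pow_le_pow_of_le_one hb0.le hb1.le (Nat.le_succ l)).trans hl.le⟩
  set e := l + 1 + 2 * n with he
  have hlq : (r / d) ^ l * (2 / t) / (1 - t) ^ l * M ≤ q ^ e := by
    have h1 : (r / d) ^ l = b ^ l * q ^ l * (1 - t) ^ l := by
      rw [← mul_pow, ← mul_pow, hb]
      congr 1
      field_simp
    rw [h1]
    calc b ^ l * q ^ l * (1 - t) ^ l * (2 / t) / (1 - t) ^ l * M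
        = b ^ l * (q ^ l * (2 * M / t)) := by field_simp
      _ ≤ q ^ (1 + 2 * n) * t / (2 * M) * (q ^ l * (2 * M / t)) := by gcongr
      _ = q ^ (1 + 2 * n) * q ^ l := by field_simp
      _ = q ^ e := by rw [← pow_add]; congr 1; omega
  set X : ℝ := (1 + ∑ i, ‖v i‖) / d with hX
  have hX0 : 0 < X := by
    have : 0 ≤ ∑ i, ‖v i‖ := Finset.sum_nonneg fun _ _ => norm_nonneg _
    positivity
  -- `B ^ m` bounds the first factor near every `v i`; it may be large, and the second factor
  -- compensates for it.
  set B : ℝ := X ^ l * ((1 + X) / t) / (1 - t) ^ l with hB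
  have hB0 : 0 < B := by positivity
  obtain ⟨η, hη0, hηt, hη2, hηB⟩ : ∃ η : ℝ, 0 < η ∧ η ≤ t ∧ η ≤ 1 / 2 ∧
      max 1 B * (8 * η) ≤ q ^ e := by
    refine ⟨min t (min (1 / 2) (q ^ e / (8 * max 1 B))), ?_, min_le_left _ _,
      (min_le_right _ _).trans (min_le_left _ _), ?_⟩
    · have : 0 < q ^ e / (8 * max 1 B) := by positivity
      exact lt_min ht0 (lt_min (by norm_num) this)
    · have h1 := (min_le_right t _).trans (min_le_right (1 / 2) (q ^ e / (8 * max 1 B)))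
      rw [le_div_iff₀ (by positivity)] at h1
      linarith
  obtain ⟨δ, hδ0, hδ⟩ := exists_pos_forall_norm_eval_sub_le P v hη0
  refine ⟨e, by omega, min (min δ 1) (η * d), by positivity,
    -- The first factor is small on the disc and close to `1` near `v j`; the second is small near
    -- the other `v i`. Their degrees are at most `(l + 1) * m` and `2 * m * n`, whence `e`.
    fun m j => (hermiteStep (l * m - 1) m).comp (Polynomial.C (v j)⁻¹ * Polynomial.X) *
      (hermiteStep (1 * m - 1) m).comp (P j), fun m hm j => ⟨?_, ?_, ?_⟩⟩
  · have h1 : ((hermiteStep (l * m - 1) m).comp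
        (Polynomial.C (v j)⁻¹ * Polynomial.X)).natDegree ≤ l * m + m := by
      refine Polynomial.natDegree_comp_le.trans ?_
      have h2 : (hermiteStep (l * m - 1) m).natDegree ≤ l * m + m := by
        have h3 := natDegree_hermiteStep_le (l * m - 1) m
        have h4 : 0 < l * m := Nat.mul_pos hl1 hm
        omega
      have h3 : (Polynomial.C (v j)⁻¹ * Polynomial.X).natDegree ≤ 1 :=
        (Polynomial.natDegree_C_mul_le _ _).trans Polynomial.natDegree_X_le
      nlinarith
    have h2 : ((hermiteStep (1 * m - 1) m).comp (P j)).natDegree ≤ (m + m) * n := by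
      refine Polynomial.natDegree_comp_le.trans ?_
      have h2 : (hermiteStep (1 * m - 1) m).natDegree ≤ m + m := by
        have h3 := natDegree_hermiteStep_le (1 * m - 1) m
        omega
      exact Nat.mul_le_mul h2 (hPdeg j)
    refine Polynomial.natDegree_mul_le.trans ((add_le_add h1 h2).trans (le_of_eq ?_))
    rw [he]
    ring
  · intro z hz
    simp only [Polynomial.eval_mul, Polynomial.eval_comp, Polynomial.eval_C, Polynomial.eval_X,
      norm_mul]
    have hx : ‖(v j)⁻¹ * z‖ ≤ r / d := by
      rw [norm_mul, norm_inv, inv_mul_eq_div]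
      gcongr
      exact hd j
    have hx1 : ‖1 - (v j)⁻¹ * z‖ ≤ 2 := by
      refine (norm_sub_le _ _).trans ?_
      rw [norm_one]
      linarith
    have h1 := norm_eval_hermiteStep_mul_le ht0 ht1 (by linarith) hx1 hx hl1 hm
    have hy1 : ‖1 - (P j).eval z‖ ≤ 1 + R := by
      refine (norm_sub_le _ _).trans ?_
      rw [norm_one]
      linarith [hR j z hz]
    have h2 := norm_eval_hermiteStep_mul_le (t := 1 / 2) (by norm_num) (by norm_num)
      (by linarith) hy1 (hR j z hz) le_rfl hm
    calc _ ≤ ((r / d) ^ l * (2 / t) / (1 - t) ^ l) ^ m *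
          (R ^ 1 * ((1 + R) / (1 / 2)) / (1 - 1 / 2) ^ 1) ^ m :=
          mul_le_mul h1 h2 (norm_nonneg _) (by positivity)
      _ = ((r / d) ^ l * (2 / t) / (1 - t) ^ l * M) ^ m := by
          rw [← mul_pow, hM]
          congr 2
          ring
      _ ≤ (q ^ e) ^ m := by gcongr
      _ = _ := (pow_mul _ _ _).symm
  · intro i z hz
    have hzδ : ‖z - v i‖ ≤ δ := hz.trans ((min_le_left _ _).trans (min_le_left _ _))
    have hz1 : ‖z - v i‖ ≤ 1 := hz.trans ((min_le_left _ _).trans (min_le_right _ _))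
    have hzd : ‖z - v i‖ ≤ η * d := hz.trans (min_le_right _ _)
    simp only [Polynomial.eval_mul, Polynomial.eval_comp, Polynomial.eval_C, Polynomial.eval_X]
    have hPz := hδ i j z hzδ
    rw [hPv] at hPz
    have hx : ‖(v j)⁻¹ * z‖ ≤ X := by
      rw [norm_mul, norm_inv, inv_mul_eq_div]
      have h1 : ‖z‖ ≤ 1 + ∑ i, ‖v i‖ := by
        have h2 := Finset.single_le_sum (f := fun i => ‖v i‖) (fun i _ => norm_nonneg (v i))
          (Finset.mem_univ i)
        have h3 := norm_le_norm_add_norm_sub (v i) z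
        rw [norm_sub_rev] at h3
        linarith [norm_sub_rev z (v i)]
      rw [hX]
      gcongr
      exact hd j
    have hx1 : ‖1 - (v j)⁻¹ * z‖ ≤ 1 + X := by
      refine (norm_sub_le _ _).trans ?_
      rw [norm_one]
      linarith
    have h1 := norm_eval_hermiteStep_mul_le ht0 ht1 (by linarith) hx1 hx hl1 hm
    rw [← hB] at h1
    have hBq : (B * (8 * η)) ^ m ≤ q ^ (e * m) := by
      rw [pow_mul]
      refine pow_le_pow_left₀ (by positivity) (le_trans ?_ hηB) _
      gcongr
      exact le_max_right _ _
    have hqm : 0 < q ^ (e * m) := by positivity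
    set T₁ := (hermiteStep (l * m - 1) m).eval ((v j)⁻¹ * z) with hT₁
    set T₂ := (hermiteStep (1 * m - 1) m).eval ((P j).eval z) with hT₂
    by_cases hij : i = j
    · subst hij
      simp only [if_true] at hPz ⊢
      rw [norm_sub_rev] at hPz
      have hy : ‖(P i).eval z‖ ≤ 2 := by
        have h3 := norm_le_norm_add_norm_sub (1 : ℂ) ((P i).eval z)
        rw [norm_one] at h3
        linarith [norm_sub_rev (1 : ℂ) ((P i).eval z)]
      have h2 := norm_one_sub_eval_hermiteStep_mul_le (t := 1 / 2) (by norm_num) (by norm_num)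
        hη2 hPz hy le_rfl hm
      have hxη : ‖1 - (v i)⁻¹ * z‖ ≤ η := by
        have : 1 - (v i)⁻¹ * z = (v i)⁻¹ * (v i - z) := by
          rw [mul_sub, inv_mul_cancel₀ (norm_pos_iff.1 (hv0 i))]
        rw [this, norm_mul, norm_inv, inv_mul_eq_div, div_le_iff₀ (hv0 i), norm_sub_rev]
        exact hzd.trans (by gcongr; exact hd i)
      have h3 := norm_one_sub_eval_hermiteStep_mul_le ht0 ht1 hηt hxη hx hl1 hm
      have h4 : X ^ l * (η / t) / (1 - t) ^ l ≤ B * (8 * η) := by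
        rw [hB]
        calc X ^ l * (η / t) / (1 - t) ^ l = X ^ l * (1 / t) / (1 - t) ^ l * (1 * η) := by ring
          _ ≤ _ := by gcongr <;> linarith
      calc ‖1 - T₁ * T₂‖ = ‖(1 - T₁) + T₁ * (1 - T₂)‖ := by congr 1; ring
        _ ≤ ‖1 - T₁‖ + ‖T₁‖ * ‖1 - T₂‖ := (norm_add_le _ _).trans (by rw [norm_mul])
        _ ≤ (B * (8 * η)) ^ m + B ^ m * (8 * η) ^ m := by
            gcongr
            · exact h3.trans (by gcongr)
            · refine h2.trans (le_of_eq ?_)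
              congr 1
              ring
        _ ≤ 2 * q ^ (e * m) := by rw [← mul_pow]; linarith
    · simp only [hij, if_false, sub_zero, zero_sub, norm_neg] at hPz ⊢
      have hy1 : ‖1 - (P j).eval z‖ ≤ 2 := by
        refine (norm_sub_le _ _).trans ?_
        rw [norm_one]
        linarith
      have h2 := norm_eval_hermiteStep_mul_le (t := 1 / 2) (by norm_num) (by norm_num)
        (by norm_num) hy1 hPz le_rfl hm
      calc ‖T₁ * T₂‖ = ‖T₁‖ * ‖T₂‖ := norm_mul _ _
        _ ≤ B ^ m * (8 * η) ^ m := by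
            gcongr
            refine h2.trans (le_of_eq ?_)
            congr 1
            ring
        _ ≤ 2 * q ^ (e * m) := by rw [← mul_pow]; linarith

/-! ### The lower bound. -/

/-- Outside the disc, the maximum principle is applied to the reversed polynomial `x ^ n * p (1 /
x)` on the disc of radius `1 / s`. -/
theorem norm_eval_le_of_forall_sphere {p : Polynomial ℂ} {n : ℕ} (hp : p.natDegree ≤ n)
    {s A M : ℝ} (hs : 0 < s) (hsA : s ≤ A) (hM : ∀ z, ‖z‖ = s → ‖p.eval z‖ ≤ M) {w : ℂ}
    (hw : ‖w‖ ≤ A) : ‖p.eval w‖ ≤ M * (A / s) ^ n := by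
  have max_principle (q : Polynomial ℂ) {ρ N : ℝ} (hρ : 0 < ρ)
      (hN : ∀ z, ‖z‖ = ρ → ‖q.eval z‖ ≤ N) {x : ℂ} (hx : ‖x‖ ≤ ρ) : ‖q.eval x‖ ≤ N := by
    refine Complex.norm_le_of_forall_mem_frontier_norm_le (U := Metric.ball 0 ρ)
      (f := fun z => q.eval z) Metric.isBounded_ball q.differentiable.diffContOnCl ?_ ?_
    · intro z hz
      rw [frontier_ball _ hρ.ne'] at hz
      exact hN z (by simpa using hz)
    · rw [closure_ball _ hρ.ne']
      simpa using hx
  have hM0 : 0 ≤ M := (norm_nonneg _).trans (hM (s : ℂ) (by simp [hs.le]))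
  have hA : 0 < A := hs.trans_le hsA
  rcases le_total ‖w‖ s with hws | hws
  · refine (max_principle p hs hM hws).trans (le_mul_of_one_le_right hM0 ?_)
    exact one_le_pow₀ ((one_le_div hs).2 hsA)
  · have key (x : ℂ) (hx : x ≠ 0) : (p.reflect n).eval x⁻¹ * x ^ n = p.eval x := by
      let _ := invertibleOfNonzero hx
      have := Polynomial.eval₂_reflect_mul_pow (RingHom.id ℂ) x n p hp
      rwa [invOf_eq_inv] at this
    have hw0 : w ≠ 0 := norm_pos_iff.1 (hs.trans_le hws)
    have h1 : ‖(p.reflect n).eval w⁻¹‖ ≤ M / s ^ n := by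
      refine max_principle _ (inv_pos.2 hs) ?_ (by rw [norm_inv]; gcongr)
      intro z hz
      have hz0 : z ≠ 0 := norm_pos_iff.1 (hz ▸ inv_pos.2 hs)
      have hz' : ‖z⁻¹‖ = s := by rw [norm_inv, hz, inv_inv]
      have h2 := key z⁻¹ (inv_ne_zero hz0)
      rw [inv_inv] at h2
      have h3 := hM z⁻¹ hz'
      rw [← h2, norm_mul, norm_pow, hz'] at h3
      rwa [le_div_iff₀ (by positivity)]
    rw [← key w hw0, norm_mul, norm_pow]
    calc _ ≤ M / s ^ n * A ^ n := by gcongr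
      _ = _ := by rw [div_pow]; ring

/-- Overconvergence: once `n` is at least the degree of `p`, the difference `P n - p` has degree at
most `n` and the growth estimate gives `(R * (A / s)) ^ n`. -/
theorem tendsto_eval_of_forall_mem_closedBall {P : ℕ → Polynomial ℂ} {p : Polynomial ℂ} {z : ℂ}
    {s R A : ℝ} (hs : 0 < s) (hR : 0 ≤ R) (hsA : s ≤ A) (hRA : R * (A / s) < 1)
    (hdeg : ∀ n, (P n).natDegree ≤ n)
    (hP : ∀ᶠ n in Filter.atTop, ∀ x ∈ Metric.closedBall z s,
      ‖(P n).eval x - p.eval x‖ ≤ R ^ n) {w : ℂ} (hw : dist w z ≤ A) :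
    Filter.Tendsto (fun n => (P n).eval w) Filter.atTop (nhds (p.eval w)) := by
  have hA : 0 < A := hs.trans_le hsA
  refine tendsto_iff_norm_sub_tendsto_zero.2 (squeeze_zero' (.of_forall fun _ => norm_nonneg _) ?_
    (tendsto_pow_atTop_nhds_zero_of_lt_one (by positivity) hRA))
  filter_upwards [hP, Filter.eventually_ge_atTop p.natDegree] with n hn hpn
  have hq : ((P n - p).comp (Polynomial.X + Polynomial.C z)).natDegree ≤ n := by
    rw [Polynomial.natDegree_comp, Polynomial.natDegree_X_add_C, mul_one]
    exact Polynomial.natDegree_sub_le_of_le (hdeg n) hpn |>.trans (by simp)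
  have h := norm_eval_le_of_forall_sphere hq hs hsA (M := R ^ n) (w := w - z) (fun x hx => ?_)
    (by rwa [← dist_eq_norm])
  · simpa [Polynomial.eval_comp, mul_pow] using h
  · simpa [Polynomial.eval_comp] using hn (x + z) (by simp [hx])

theorem IsPreconnected.infinite_inter_ball {S : Set ℂ} (hS : IsPreconnected S) (hS' : S.Nontrivial)
    {w : ℂ} (hw : w ∈ S) {ε : ℝ} (hε : 0 < ε) : (S ∩ Metric.ball w ε).Infinite := by
  have h := hS.preperfect_of_nontrivial hS' w hw
  rw [Set.inter_comm]
  exact Set.Infinite.of_accPt (h.nhds_inter (Metric.ball_mem_nhds w hε))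

theorem exists_natDegree_le_of_polyDist_lt {K : Set ℂ} {F : ℂ → ℂ} {n : ℕ} {a : ℝ≥0∞}
    (h : polyDist K F n < a) :
    ∃ p : Polynomial ℂ, p.natDegree ≤ n ∧ ∀ x ∈ K, ‖F x - p.eval x‖ₑ ≤ a := by
  simp only [polyDist, iInf_lt_iff] at h
  obtain ⟨p, hp, hpa⟩ := h
  refine ⟨p, Polynomial.natDegree_le_iff_degree_le.2 (Polynomial.mem_degreeLE.1 hp), ?_⟩
  intro x hx
  exact (le_iSup₂ (f := fun z (_ : z ∈ K) => ‖F z - p.eval z‖ₑ) x hx).trans hpa.le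

theorem exists_polynomials_of_factor_lt {K : Set ℂ} {F : ℂ → ℂ} {R : NNReal}
    (h : asymptoticConvergenceFactor K F < R) :
    ∃ P : ℕ → Polynomial ℂ, (∀ n, (P n).natDegree ≤ n) ∧
      ∀ᶠ n in Filter.atTop, ∀ x ∈ K, ‖(P n).eval x - F x‖ ≤ (R : ℝ) ^ n := by
  have h1 : ∀ᶠ n : ℕ in Filter.atTop, ∃ p : Polynomial ℂ, p.natDegree ≤ n ∧
      ∀ x ∈ K, ‖p.eval x - F x‖ ≤ (R : ℝ) ^ n := by
    filter_upwards [Filter.eventually_lt_of_limsup_lt h, Filter.eventually_gt_atTop 0] with n hn h0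
    have h2 : polyDist K F n < ((R ^ n : NNReal) : ℝ≥0∞) := by
      rw [ENNReal.coe_pow, ← ENNReal.rpow_inv_natCast_pow h0.ne' (polyDist K F n), ← one_div]
      exact ENNReal.pow_lt_pow_left h0.ne' hn
    obtain ⟨p, hp, hpx⟩ := exists_natDegree_le_of_polyDist_lt h2
    refine ⟨p, hp, fun x hx => ?_⟩
    have := hpx x hx
    rw [enorm_le_coe, ← NNReal.coe_le_coe, coe_nnnorm, norm_sub_rev] at this
    simpa using this
  obtain ⟨N, hN⟩ := Filter.eventually_atTop.1 h1
  choose! P hP using hN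
  refine ⟨fun n => if N ≤ n then P n else 0, fun n => ?_, ?_⟩
  · dsimp only
    split_ifs with hn
    · exact (hP n hn).1
    · simp
  · filter_upwards [Filter.eventually_ge_atTop N] with n hn
    simpa only [if_pos hn] using (hP n hn).2

theorem IsAdmissible.isPreconnected {n₀ : ℕ} {K : Set ℂ} {C : Fin (n₀ + 1) → Set ℂ}
    (h : IsAdmissible K C) (i : Fin (n₀ + 1)) : IsPreconnected (C i) := by
  have hi : C i ∈ Set.range C := ⟨i, rfl⟩
  rw [h.range_eq] at hi
  obtain ⟨z, -, hz⟩ := hi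
  exact hz ▸ isPreconnected_connectedComponentIn

theorem IsAdmissible.subset {n₀ : ℕ} {K : Set ℂ} {C : Fin (n₀ + 1) → Set ℂ}
    (h : IsAdmissible K C) (i : Fin (n₀ + 1)) : C i ⊆ K := by
  have hi : C i ∈ Set.range C := ⟨i, rfl⟩
  rw [h.range_eq] at hi
  obtain ⟨z, -, hz⟩ := hi
  exact hz ▸ connectedComponentIn_subset K z

theorem IsAdmissible.exists_mem {n₀ : ℕ} {K : Set ℂ} {C : Fin (n₀ + 1) → Set ℂ}
    (h : IsAdmissible K C) {z : ℂ} (hz : z ∈ K) : ∃ i, z ∈ C i := by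
  have hi : connectedComponentIn K z ∈ Set.range C := by
    rw [h.range_eq]
    exact ⟨z, hz, rfl⟩
  obtain ⟨i, hi⟩ := hi
  exact ⟨i, hi ▸ mem_connectedComponentIn hz⟩

theorem geometricLowerBound_le {n₀ : ℕ} {K : Set ℂ} {C : Fin (n₀ + 1) → Set ℂ}
    (hK : IsAdmissible K C) {F : ℂ → ℂ} (hF : IsPiecewisePolynomial C F) :
    geometricLowerBound K C ≤ asymptoticConvergenceFactor K F := by
  obtain ⟨p, hpinj, hp⟩ := hF
  refine iSup_le fun i => iSup₂_le fun z _ => le_of_not_gt fun hlt => ?_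
  obtain ⟨R, hFR, hRlt⟩ := ENNReal.lt_iff_exists_nnreal_btwn.1 hlt
  obtain ⟨s, hRs, hsr⟩ := ENNReal.lt_iff_exists_nnreal_btwn.1 (ENNReal.mul_lt_of_lt_div hRlt)
  have hR0 : 0 < R := by
    have := bot_le.trans_lt hFR
    simpa using this
  have hs0 : 0 < s := by
    have := bot_le.trans_lt hRs
    simpa using this
  have hball : ∀ x ∈ Metric.closedBall z s, x ∈ C i := by
    intro x hx
    by_contra hxC
    have h1 := Metric.infEDist_le_edist_of_mem (x := z) (s := (C i)ᶜ) hxC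
    have h2 : edist z x ≤ s := by
      rw [edist_comm, edist_nndist, ENNReal.coe_le_coe, ← NNReal.coe_le_coe, coe_nndist]
      exact hx
    exact absurd (hsr.trans_le (h1.trans h2)) (lt_irrefl _)
  have hd : Metric.infEDist z (K \ C i) < ((s / R : NNReal) : ℝ≥0∞) := by
    rw [ENNReal.coe_div hR0.ne', ENNReal.lt_div_iff_mul_lt (by simp [hR0.ne']) (by simp), mul_comm]
    exact hRs
  obtain ⟨w, ⟨hwK, hwC⟩, hw⟩ := Metric.infEDist_lt_iff.1 hd
  have hwd : dist w z < s / R := by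
    rw [edist_comm, edist_nndist, ENNReal.coe_lt_coe, ← NNReal.coe_lt_coe, coe_nndist] at hw
    simpa using hw
  obtain ⟨A, hwA, hA⟩ := exists_between hwd
  -- The point `w` is outside `C i`, hence outside the disc of radius `s`. With `A < s / R` this
  -- also forces `R < 1`.
  have hsA : (s : ℝ) ≤ A := by
    by_contra! hAs
    exact hwC (hball w (hwA.trans hAs).le)
  obtain ⟨P, hPdeg, hP⟩ := exists_polynomials_of_factor_lt hFR
  have hR0' : (0 : ℝ) < R := hR0
  have hs0' : (0 : ℝ) < s := hs0
  have hlim : ∀ x ∈ K, Filter.Tendsto (fun n => (P n).eval x) Filter.atTop (nhds (F x)) := by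
    intro x hx
    have hR1 : (R : ℝ) < 1 := by
      by_contra! h1
      have := div_le_self hs0'.le h1
      linarith
    refine tendsto_iff_norm_sub_tendsto_zero.2 (squeeze_zero' (.of_forall fun _ => norm_nonneg _)
      ?_ (tendsto_pow_atTop_nhds_zero_of_lt_one hR0'.le hR1))
    filter_upwards [hP] with n hn using hn x hx
  have hFp : ∀ x ∈ K, dist x z ≤ A → F x = (p i).eval x := by
    intro x hx hxA
    refine tendsto_nhds_unique (hlim x hx)
      (tendsto_eval_of_forall_mem_closedBall hs0' hR0'.le hsA ?_ hPdeg ?_ hxA)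
    · rw [lt_div_iff₀ hR0'] at hA
      rw [← mul_div_assoc, div_lt_one hs0']
      linarith
    · filter_upwards [hP] with n hn x hx
      rw [← hp i x (hball x hx)]
      exact hn x (hK.subset i (hball x hx))
  obtain ⟨j, hj⟩ := hK.exists_mem hwK
  have hij : j ≠ i := fun h => hwC (h ▸ hj)
  refine hij (hpinj (Polynomial.eq_of_infinite_eval_eq _ _ ?_))
  -- A nontrivial connected set has infinitely many points near `w`, and those within `A - dist w z`
  -- of `w` stay in the disc of radius `A`.
  refine ((hK.isPreconnected j).infinite_inter_ball (hK.nontrivial j) hj (sub_pos.2 hwA)).mono ?_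
  rintro x ⟨hxj, hxw⟩
  rw [Metric.mem_ball] at hxw
  rw [Set.mem_ofPred_eq, ← hp j x hxj]
  refine hFp x (hK.subset j hxj) ?_
  linarith [dist_triangle x w z]

/-! ### The extremal sets: a disc with segments on a ray. -/

theorem connectedComponentIn_iUnion_eq {ι X : Type*} [Finite ι] [TopologicalSpace X]
    {C : ι → Set X} (hclosed : ∀ i, IsClosed (C i)) (hconn : ∀ i, IsPreconnected (C i))
    (hdisj : Pairwise (Function.onFun Disjoint C)) {i : ι} {z : X} (hz : z ∈ C i) :
    connectedComponentIn (⋃ j, C j) z = C i := by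
  refine Set.Subset.antisymm ?_
    ((hconn i).subset_connectedComponentIn hz (Set.subset_iUnion C i))
  have hd : Disjoint (C i) (⋃ (j) (_ : j ≠ i), C j) :=
    Set.disjoint_iUnion₂_right.2 fun j hj => hdisj hj.symm
  have h := isPreconnected_iff_subset_of_disjoint_closed.1
    (isPreconnected_connectedComponentIn (F := ⋃ j, C j) (x := z)) (C i)
    (⋃ (j) (_ : j ≠ i), C j) (hclosed i)
    (isClosed_iUnion_of_finite fun j => isClosed_iUnion_of_finite fun _ => hclosed j) ?_ ?_
  · refine h.resolve_right fun h' => ?_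
    exact Set.disjoint_left.1 hd hz
      (h' (mem_connectedComponentIn (Set.mem_iUnion_of_mem i hz)))
  · intro x hx
    obtain ⟨j, hj⟩ := Set.mem_iUnion.1 (connectedComponentIn_subset _ _ hx)
    by_cases hji : j = i
    · exact Or.inl (hji ▸ hj)
    · exact Or.inr (Set.mem_iUnion₂.2 ⟨j, hji, hj⟩)
  · rw [hd.inter_eq, Set.inter_empty]

theorem isAdmissible_iUnion {n₀ : ℕ} {C : Fin (n₀ + 1) → Set ℂ} (hcomp : ∀ i, IsCompact (C i))
    (hconn : ∀ i, IsPreconnected (C i)) (hnt : ∀ i, (C i).Nontrivial)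
    (hdisj : Pairwise (Function.onFun Disjoint C)) (hcompl : IsConnected (⋃ i, C i)ᶜ) :
    IsAdmissible (⋃ i, C i) C where
  isCompact := isCompact_iUnion hcomp
  isConnected_compl := hcompl
  injective i j hij := by
    by_contra h
    have h1 : Disjoint (C i) (C j) := hdisj h
    rw [← hij, disjoint_self] at h1
    exact (hnt i).nonempty.ne_empty h1
  range_eq := by
    have h {i z} (hz : z ∈ C i) := connectedComponentIn_iUnion_eq (fun i => (hcomp i).isClosed)
      hconn hdisj hz
    ext S
    constructor
    · rintro ⟨i, rfl⟩
      obtain ⟨z, hz⟩ := (hnt i).nonempty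
      exact ⟨z, Set.mem_iUnion_of_mem i hz, (h hz).symm⟩
    · rintro ⟨z, hz, rfl⟩
      obtain ⟨i, hi⟩ := Set.mem_iUnion.1 hz
      exact ⟨i, (h hi).symm⟩
  nontrivial := hnt

/-- The plane slit along the ray, minus the disc, is a polar-coordinate image of a product of
intervals. `Kᶜ` lies between this connected set and its closure. -/
theorem isConnected_compl_of_subset_closedBall_union_ray {c : ℂ} {r : ℝ} (hr : 0 ≤ r) {K : Set ℂ}
    (hrK : Metric.closedBall c r ⊆ K)
    (hKr : ∀ z ∈ K, z ∈ Metric.closedBall c r ∨ ∃ x : ℝ, 0 < x ∧ z = c + x) :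
    IsConnected Kᶜ := by
  -- The minus sign places the excluded angles `±π` on the positive ray.
  set f : ℝ × ℝ → ℂ := fun p => c - p.1 * Complex.exp (p.2 * Complex.I) with hf
  set s : Set (ℝ × ℝ) := Set.Ioi r ×ˢ Set.Ioo (-Real.pi) Real.pi with hs
  have hfc : Continuous f := by fun_prop
  have hsc : IsConnected s := isConnected_Ioi.prod (isConnected_Ioo (by linarith [Real.pi_pos]))
  have hnorm (p : ℝ × ℝ) : ‖f p - c‖ = |p.1| := by
    simp [hf, Complex.norm_exp_ofReal_mul_I]
  refine (hsc.image f hfc.continuousOn).subset_closure ?_ ?_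
  · rintro _ ⟨⟨ρ, θ⟩, ⟨hρ, hθ⟩, rfl⟩ hK
    simp only [Set.mem_Ioi] at hρ
    have hρ0 : 0 < ρ := hr.trans_lt hρ
    rcases hKr _ hK with h | ⟨x, hx, h⟩
    · rw [mem_closedBall_iff_norm, hnorm, abs_of_pos hρ0] at h
      linarith
    · have h1 : (ρ : ℂ) * Complex.exp (θ * Complex.I) = -x := by
        simp only [hf] at h
        linear_combination -h
      have him := congrArg Complex.im h1
      have hre := congrArg Complex.re h1
      rw [Complex.exp_mul_I] at him hre
      simp [← Complex.ofReal_cos, ← Complex.ofReal_sin] at him hre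
      have hsin : Real.sin θ = 0 := by
        rcases him with him | him
        · exact absurd him hρ0.ne'
        · exact him
      replace hsin : θ = 0 := (Real.sin_eq_zero_iff_of_lt_of_lt hθ.1 hθ.2).1 hsin
      rw [hsin, Real.cos_zero] at hre
      linarith
  · intro z hz
    have hzr : r < ‖z - c‖ := by
      by_contra! h
      exact hz (hrK (mem_closedBall_iff_norm.2 h))
    refine image_closure_subset_closure_image hfc ⟨(‖c - z‖, Complex.arg (c - z)), ?_, ?_⟩
    · rw [hs, closure_prod_eq, closure_Ioi, closure_Ioo (by linarith [Real.pi_pos])]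
      refine ⟨?_, (Complex.neg_pi_lt_arg _).le, Complex.arg_le_pi _⟩
      rw [Set.mem_Ici, norm_sub_rev]
      exact hzr.le
    · simp only [hf]
      rw [Complex.norm_mul_exp_arg_mul_I, sub_sub_cancel]

theorem infEDist_compl_closedBall_le {c z : ℂ} {r : ℝ} (hz : ‖z - c‖ ≤ r) :
    Metric.infEDist z (Metric.closedBall c r)ᶜ ≤ ENNReal.ofReal (r - ‖z - c‖) := by
  refine ENNReal.le_of_forall_pos_le_add fun η hη _ => ?_
  -- The outward radial direction; as `Complex.arg 0 = 0`, it is still a unit vector when `z = c`.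
  set u := Complex.exp (Complex.arg (z - c) * Complex.I) with hu
  have hu1 : ‖u‖ = 1 := Complex.norm_exp_ofReal_mul_I _
  have hzu : z = c + ‖z - c‖ * u := by
    rw [hu, Complex.norm_mul_exp_arg_mul_I]
    ring
  have hη' : (0 : ℝ) < η := hη
  have hmem : c + ((r + η : ℝ) : ℂ) * u ∈ (Metric.closedBall c r)ᶜ := by
    rw [Set.mem_compl_iff, mem_closedBall_iff_norm, add_sub_cancel_left, norm_mul, hu1,
      Complex.norm_real, Real.norm_eq_abs, mul_one, not_le]
    exact (lt_add_of_pos_right r hη').trans_le (le_abs_self _)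
  refine (Metric.infEDist_le_edist_of_mem hmem).trans ?_
  rw [edist_dist, dist_eq_norm, ← ENNReal.ofReal_coe_nnreal,
    ← ENNReal.ofReal_add (by linarith) hη'.le]
  refine ENNReal.ofReal_le_ofReal ?_
  have : z - (c + ((r + η : ℝ) : ℂ) * u) = ((‖z - c‖ - (r + η) : ℝ) : ℂ) * u := by
    nth_rw 1 [hzu]
    push_cast
    ring
  rw [this, norm_mul, hu1, mul_one, Complex.norm_real, Real.norm_eq_abs,
    abs_of_nonpos (by linarith)]
  linarith

/-- The closed disc with centre `c` and radius `r`, followed by the segments of length `δ` that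
start at `c + d, c + 2 d, …` and point in the direction of the positive real axis. -/
noncomputable def discAndSegments (n₀ : ℕ) (c : ℂ) (r d δ : ℝ) : Fin (n₀ + 1) → Set ℂ :=
  Fin.cons (Metric.closedBall c r) fun j : Fin n₀ =>
    (fun x : ℝ => c + x) '' Set.Icc (d * (j + 1)) (d * (j + 1) + δ)

section discAndSegments

variable {n₀ : ℕ} {c : ℂ} {r d δ : ℝ}

@[simp]
theorem discAndSegments_zero : discAndSegments n₀ c r d δ 0 = Metric.closedBall c r := rfl

@[simp]
theorem discAndSegments_succ (j : Fin n₀) : discAndSegments n₀ c r d δ j.succ =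
    (fun x : ℝ => c + x) '' Set.Icc (d * (j + 1)) (d * (j + 1) + δ) := rfl

theorem le_of_mem_discAndSegments_succ (hd : 0 < d) {j : Fin n₀} {z : ℂ}
    (hz : z ∈ discAndSegments n₀ c r d δ j.succ) : ∃ x : ℝ, d ≤ x ∧ z = c + x := by
  obtain ⟨x, hx, rfl⟩ := hz
  refine ⟨x, le_trans ?_ hx.1, rfl⟩
  have : (0 : ℝ) ≤ (j : ℕ) := Nat.cast_nonneg _
  nlinarith

theorem pairwise_disjoint_discAndSegments (hr : 0 < r) (hrd : r < d) (hδd : δ < d) :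
    Pairwise (Function.onFun Disjoint (discAndSegments n₀ c r d δ)) := by
  have hd : 0 < d := hr.trans hrd
  have h0 (j : Fin n₀) : Disjoint (discAndSegments n₀ c r d δ 0)
      (discAndSegments n₀ c r d δ j.succ) := by
    refine Set.disjoint_left.2 fun z hz hz' => ?_
    obtain ⟨x, hx, rfl⟩ := le_of_mem_discAndSegments_succ hd hz'
    rw [discAndSegments_zero, mem_closedBall_iff_norm, add_sub_cancel_left, Complex.norm_real,
      Real.norm_eq_abs] at hz
    linarith [le_abs_self x]
  have hlt (i j : Fin n₀) (hij : i < j) : Disjoint (discAndSegments n₀ c r d δ i.succ)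
      (discAndSegments n₀ c r d δ j.succ) := by
    refine Set.disjoint_left.2 ?_
    rintro _ ⟨x, hx, rfl⟩ ⟨y, hy, hxy⟩
    have hxy' : y = x := by simpa using hxy
    subst hxy'
    have h1 : ((i : ℕ) : ℝ) + 1 ≤ (j : ℕ) := by exact_mod_cast hij
    have := hx.2
    have := hy.1
    nlinarith
  intro i j hij
  induction i using Fin.cases with
  | zero =>
    induction j using Fin.cases with
    | zero => exact absurd rfl hij
    | succ j => exact h0 j
  | succ i =>
    induction j using Fin.cases with
    | zero => exact (h0 i).symm
    | succ j =>
      rcases lt_trichotomy i j with h | h | h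
      · exact hlt i j h
      · exact absurd (congrArg _ h) hij
      · exact (hlt j i h).symm

theorem isAdmissible_discAndSegments (hr : 0 < r) (hrd : r < d) (hδ : 0 < δ) (hδd : δ < d) :
    IsAdmissible (⋃ i, discAndSegments n₀ c r d δ i) (discAndSegments n₀ c r d δ) := by
  have hd : 0 < d := hr.trans hrd
  have hcont : Continuous fun x : ℝ => c + (x : ℂ) := by fun_prop
  refine isAdmissible_iUnion (fun i => ?_) (fun i => ?_) (fun i => ?_)
    (pairwise_disjoint_discAndSegments hr hrd hδd)
    (isConnected_compl_of_subset_closedBall_union_ray (c := c) hr.le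
      (Set.subset_iUnion (discAndSegments n₀ c r d δ) 0) fun z hz => ?_)
  · cases i using Fin.cases with
    | zero => exact isCompact_closedBall c r
    | succ j => exact isCompact_Icc.image hcont
  · cases i using Fin.cases with
    | zero => exact (convex_closedBall c r).isPreconnected
    | succ j => exact isPreconnected_Icc.image _ hcont.continuousOn
  · cases i using Fin.cases with
    | zero =>
      refine ⟨c, Metric.mem_closedBall_self hr.le, c + (r : ℂ), ?_, ?_⟩
      · rw [discAndSegments_zero, mem_closedBall_iff_norm, add_sub_cancel_left, Complex.norm_real,
          Real.norm_of_nonneg hr.le]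
      · simpa using hr.ne'
    | succ j =>
      refine ⟨_, ⟨d * (j + 1), Set.left_mem_Icc.2 (by linarith), rfl⟩,
        _, ⟨d * (j + 1) + δ, Set.right_mem_Icc.2 (by linarith), rfl⟩, ?_⟩
      simpa using Complex.ofReal_ne_zero.2 hδ.ne'
  · obtain ⟨i, hi⟩ := Set.mem_iUnion.1 hz
    cases i using Fin.cases with
    | zero => exact Or.inl hi
    | succ j =>
      obtain ⟨x, hx, hzx⟩ := le_of_mem_discAndSegments_succ hd hi
      exact Or.inr ⟨x, hd.trans_le hx, hzx⟩

theorem interior_discAndSegments_succ (j : Fin n₀) :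
    interior (discAndSegments n₀ c r d δ j.succ) = ∅ := by
  refine Set.eq_empty_of_forall_notMem fun z hz => ?_
  have hsub : discAndSegments n₀ c r d δ j.succ ⊆ {z | z.im ≤ c.im} := by
    rintro _ ⟨x, -, rfl⟩
    simp
  have h1 := interior_mono hsub hz
  rw [Complex.interior_setOfPred_im_le] at h1
  obtain ⟨x, -, rfl⟩ := interior_subset hz
  simp at h1

theorem le_norm_sub_of_mem_iUnion_discAndSegments (hd : 0 < d) {z : ℂ}
    (hz : z ∈ (⋃ i, discAndSegments n₀ c r d δ i) \ discAndSegments n₀ c r d δ 0) :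
    d ≤ ‖z - c‖ := by
  obtain ⟨hz, hz0⟩ := hz
  obtain ⟨i, hi⟩ := Set.mem_iUnion.1 hz
  cases i using Fin.cases with
  | zero => exact absurd hi hz0
  | succ j =>
    obtain ⟨x, hx, rfl⟩ := le_of_mem_discAndSegments_succ hd hi
    rw [add_sub_cancel_left, Complex.norm_real, Real.norm_eq_abs]
    exact hx.trans (le_abs_self x)

theorem ofReal_le_infEDist_discAndSegments (hd : 0 < d) (z : ℂ) :
    ENNReal.ofReal (d - ‖z - c‖) ≤ Metric.infEDist z
      ((⋃ i, discAndSegments n₀ c r d δ i) \ discAndSegments n₀ c r d δ 0) := by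
  refine Metric.le_infEDist.2 fun y hy => ?_
  have h1 := le_norm_sub_of_mem_iUnion_discAndSegments hd hy
  rw [edist_dist, dist_eq_norm]
  refine ENNReal.ofReal_le_ofReal ?_
  have := norm_sub_le_norm_sub_add_norm_sub y z c
  rw [norm_sub_rev y z] at this
  linarith

theorem infEDist_center_discAndSegments (hn₀ : 1 ≤ n₀) (hr : 0 < r) (hrd : r < d) (hδ : 0 < δ) :
    Metric.infEDist c ((⋃ i, discAndSegments n₀ c r d δ i) \ discAndSegments n₀ c r d δ 0) =
      ENNReal.ofReal d := by
  have hd : 0 < d := hr.trans hrd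
  have hnorm : ‖(c + (d : ℂ)) - c‖ = d := by
    rw [add_sub_cancel_left, Complex.norm_real, Real.norm_of_nonneg hd.le]
  refine le_antisymm ?_ ?_
  · have hmem : c + (d : ℂ) ∈
        (⋃ i, discAndSegments n₀ c r d δ i) \ discAndSegments n₀ c r d δ 0 := by
      refine ⟨?_, ?_⟩
      · refine Set.mem_iUnion_of_mem (Fin.succ (⟨0, hn₀⟩ : Fin n₀)) ?_
        rw [discAndSegments_succ]
        exact ⟨d, by simp [hδ.le], rfl⟩
      · rw [discAndSegments_zero, mem_closedBall_iff_norm, hnorm]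
        exact not_le.2 hrd
    refine (Metric.infEDist_le_edist_of_mem hmem).trans ?_
    rw [edist_dist, dist_comm, dist_eq_norm, hnorm]
  · simpa using ofReal_le_infEDist_discAndSegments (n₀ := n₀) (c := c) (r := r) (δ := δ) hd c

theorem geometricLowerBound_discAndSegments (hn₀ : 1 ≤ n₀) (hr : 0 < r) (hrd : r < d)
    (hδ : 0 < δ) :
    geometricLowerBound (⋃ i, discAndSegments n₀ c r d δ i) (discAndSegments n₀ c r d δ) =
      ENNReal.ofReal (r / d) := by
  have hd : 0 < d := hr.trans hrd
  refine le_antisymm (iSup_le fun i => iSup₂_le fun z hz => ?_) ?_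
  · cases i using Fin.cases with
    | succ j =>
      rw [interior_discAndSegments_succ] at hz
      exact absurd hz (Set.notMem_empty z)
    | zero =>
      rw [discAndSegments_zero, interior_closedBall _ hr.ne', mem_ball_iff_norm] at hz
      refine (ENNReal.div_le_div (infEDist_compl_closedBall_le hz.le)
        (ofReal_le_infEDist_discAndSegments hd z)).trans ?_
      rw [← ENNReal.ofReal_div_of_pos (by linarith)]
      refine ENNReal.ofReal_le_ofReal ?_
      -- `(r - x) / (d - x)` is largest at `x = 0` because `r < d`: the centre is extremal.
      rw [div_le_div_iff₀ (by linarith) hd]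
      nlinarith [norm_nonneg (z - c)]
  · refine le_iSup_of_le 0 (le_iSup₂_of_le c ?_ ?_)
    · rw [discAndSegments_zero, interior_closedBall _ hr.ne']
      exact Metric.mem_ball_self hr
    · rw [infEDist_center_discAndSegments hn₀ hr hrd hδ, ENNReal.ofReal_div_of_pos hd]
      refine ENNReal.div_le_div_right (Metric.le_infEDist.2 fun y hy => ?_) _
      rw [discAndSegments_zero, Set.mem_compl_iff, Metric.mem_closedBall, not_le] at hy
      rw [edist_comm, edist_dist]
      exact ENNReal.ofReal_le_ofReal hy.le

end discAndSegments

/-! ### The upper bound for the convergence factor. -/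

theorem polyDist_le_of_forall_norm_sub_le {K : Set ℂ} {F : ℂ → ℂ} {n : ℕ} {p : Polynomial ℂ}
    (hp : p.natDegree ≤ n) {a : ℝ} (h : ∀ z ∈ K, ‖F z - p.eval z‖ ≤ a) :
    polyDist K F n ≤ ENNReal.ofReal a := by
  refine iInf₂_le_of_le p (Polynomial.mem_degreeLE.2 (Polynomial.natDegree_le_iff_degree_le.1 hp))
    (iSup₂_le fun z hz => ?_)
  rw [← ofReal_norm]
  exact ENNReal.ofReal_le_ofReal (h z hz)

theorem asymptoticConvergenceFactor_le {K : Set ℂ} {F : ℂ → ℂ} {C q q' : ℝ} (hq : 0 ≤ q)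
    (hqq' : q < q')
    (h : ∀ᶠ n : ℕ in Filter.atTop, polyDist K F n ≤ ENNReal.ofReal (C * q ^ n)) :
    asymptoticConvergenceFactor K F ≤ ENNReal.ofReal q' := by
  have hq' : 0 < q' := hq.trans_lt hqq'
  refine Filter.limsup_le_of_le (by isBoundedDefault) ?_
  have hlim : Filter.Tendsto (fun n : ℕ => C * (q / q') ^ n) Filter.atTop (nhds (C * 0)) :=
    (tendsto_pow_atTop_nhds_zero_of_lt_one (by positivity) ((div_lt_one hq').2 hqq')).const_mul C
  rw [mul_zero] at hlim
  filter_upwards [h, hlim.eventually_le_const one_pos, Filter.eventually_gt_atTop 0] with n hn h1 h0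
  have h2 : C * q ^ n ≤ q' ^ n := by
    rwa [div_pow, ← mul_div_assoc, div_le_one (by positivity)] at h1
  calc polyDist K F n ^ ((1 : ℝ) / n) ≤ (ENNReal.ofReal q' ^ n) ^ ((1 : ℝ) / n) := by
        refine ENNReal.rpow_le_rpow (hn.trans ?_) (by positivity)
        rw [← ENNReal.ofReal_pow hq'.le]
        exact ENNReal.ofReal_le_ofReal h2
    _ = ENNReal.ofReal q' := by
        rw [one_div, ENNReal.pow_rpow_inv_natCast h0.ne']

/-- The approximant is `p 0 + ∑ j, (p j.succ - p 0) * h m j`, with `h m j` recentred at `c`: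
replacing each `h m j` by the indicator of its segment would give `F` exactly. -/
theorem exists_polyDist_le {n₀ : ℕ} {c : ℂ} {r d δ q : ℝ} (hq0 : 0 < q) (hq1 : q ≤ 1) {e : ℕ}
    (he : 0 < e) {h : ℕ → Fin n₀ → Polynomial ℂ}
    (hdeg : ∀ m, 1 ≤ m → ∀ j, (h m j).natDegree ≤ e * m)
    (hdisc : ∀ m, 1 ≤ m → ∀ j z, ‖z‖ ≤ r → ‖(h m j).eval z‖ ≤ q ^ (e * m))
    (hseg : ∀ m, 1 ≤ m → ∀ (i j : Fin n₀) (z : ℂ), ‖z - (d * (i + 1) : ℝ)‖ ≤ δ →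
      ‖(if i = j then 1 else 0) - (h m j).eval z‖ ≤ 2 * q ^ (e * m))
    (hK : IsCompact (⋃ i, discAndSegments n₀ c r d δ i)) {F : ℂ → ℂ}
    (hF : IsPiecewisePolynomial (discAndSegments n₀ c r d δ) F) :
    ∃ B : ℝ, ∀ᶠ N in Filter.atTop,
      polyDist (⋃ i, discAndSegments n₀ c r d δ i) F N ≤ ENNReal.ofReal (B * q ^ N) := by
  obtain ⟨p, -, hp⟩ := hF
  have hW (j : Fin n₀) : ∃ W : ℝ, 0 ≤ W ∧ ∀ z ∈ ⋃ i, discAndSegments n₀ c r d δ i,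
      ‖(p j.succ - p 0).eval z‖ ≤ W := by
    obtain ⟨W, hW⟩ := hK.exists_bound_of_continuousOn (p j.succ - p 0).continuous.continuousOn
    exact ⟨max W 0, le_max_right _ _, fun z hz => (hW z hz).trans (le_max_left _ _)⟩
  choose W hW0 hW using hW
  set D := ∑ i, (p i).natDegree with hD
  have hpD (i) : (p i).natDegree ≤ D :=
    Finset.single_le_sum (f := fun i => (p i).natDegree) (fun _ _ => Nat.zero_le _)
      (Finset.mem_univ i)
  refine ⟨(∑ j, W j * 2) / q ^ (D + e), ?_⟩
  filter_upwards [Filter.eventually_ge_atTop (D + e)] with N hN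
  -- `D` pays for the degrees of the `p i`. Rounding down to a multiple of `e` costs only the
  -- constant factor `q ^ (-(D + e))`.
  obtain ⟨m, hm1, hmN, hNm⟩ : ∃ m, 1 ≤ m ∧ D + e * m ≤ N ∧ N ≤ e * m + (D + e) := by
    refine ⟨(N - D) / e, (Nat.one_le_div_iff he).2 (by omega), ?_, ?_⟩
    · have := Nat.mul_div_le (N - D) e
      omega
    · have := Nat.lt_mul_div_succ (N - D) he
      rw [Nat.mul_add] at this
      omega
  refine (polyDist_le_of_forall_norm_sub_le (a := (∑ j, W j * 2) * q ^ (e * m)) (p := p 0 +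
    ∑ j, (p (Fin.succ j) - p 0) * (h m j).comp (Polynomial.X - Polynomial.C c)) ?_ ?_).trans ?_
  · refine Polynomial.natDegree_add_le_of_degree_le ((hpD 0).trans (by omega))
      (Polynomial.natDegree_sum_le_of_forall_le _ _ fun j _ => ?_)
    refine Polynomial.natDegree_mul_le.trans ((add_le_add (Polynomial.natDegree_sub_le_of_le
      (hpD _) (hpD _)) ?_).trans (by rwa [max_self]))
    rw [Polynomial.natDegree_comp, Polynomial.natDegree_X_sub_C, mul_one]
    exact hdeg m hm1 j
  · intro z hz
    have key (a : Fin n₀ → ℂ) (hFz : F z = (p 0).eval z + ∑ j, (p (Fin.succ j) - p 0).eval z * a j)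
        (ha : ∀ j, ‖a j - (h m j).eval (z - c)‖ ≤ 2 * q ^ (e * m)) :
        ‖F z - (p 0 + ∑ j, (p (Fin.succ j) - p 0) *
          (h m j).comp (Polynomial.X - Polynomial.C c)).eval z‖ ≤
          (∑ j, W j * 2) * q ^ (e * m) := by
      have : F z - (p 0 + ∑ j, (p (Fin.succ j) - p 0) *
          (h m j).comp (Polynomial.X - Polynomial.C c)).eval z =
          ∑ j, (p (Fin.succ j) - p 0).eval z * (a j - (h m j).eval (z - c)) := by
        rw [hFz, Polynomial.eval_add, Polynomial.eval_finsetSum, add_sub_add_left_eq_sub,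
          ← Finset.sum_sub_distrib]
        refine Finset.sum_congr rfl fun j _ => ?_
        simp only [Polynomial.eval_mul, Polynomial.eval_comp, Polynomial.eval_sub,
          Polynomial.eval_X, Polynomial.eval_C]
        ring
      rw [this, Finset.sum_mul]
      refine norm_sum_le_of_le _ fun j _ => ?_
      rw [norm_mul, mul_assoc]
      exact mul_le_mul (hW j z hz) (ha j) (norm_nonneg _) (hW0 j)
    obtain ⟨i, hi⟩ := Set.mem_iUnion.1 hz
    have hqm : 0 < q ^ (e * m) := by positivity
    cases i using Fin.cases with
    | zero =>
      refine key 0 (by simpa using hp 0 z hi) fun j => ?_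
      rw [Pi.zero_apply, zero_sub, norm_neg]
      refine (hdisc m hm1 j _ ?_).trans (by linarith)
      rwa [discAndSegments_zero, mem_closedBall_iff_norm] at hi
    | succ i =>
      refine key (fun j => if i = j then 1 else 0) (by simpa using hp i.succ z hi) fun j =>
        hseg m hm1 i j _ ?_
      obtain ⟨x, hx, rfl⟩ := hi
      rw [add_sub_cancel_left, ← Complex.ofReal_sub, Complex.norm_real, Real.norm_eq_abs,
        abs_of_nonneg (by linarith [hx.1])]
      linarith [hx.2]
  · refine ENNReal.ofReal_le_ofReal ?_
    have hW' : 0 ≤ ∑ j, W j * 2 := Finset.sum_nonneg fun j _ => mul_nonneg (hW0 j) zero_le_two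
    rw [div_mul_eq_mul_div, le_div_iff₀ (by positivity), mul_assoc, ← pow_add]
    exact mul_le_mul_of_nonneg_left (pow_le_pow_of_le_one hq0.le hq1 hNm) hW'

theorem exists_isAdmissible_asymptoticConvergenceFactor_lt {n₀ : ℕ} (hn₀ : 1 ≤ n₀) (c : ℂ)
    {r d ε : ℝ} (hr : 0 < r) (hrd : r < d) (hε : 0 < ε) :
    ∃ (K : Set ℂ) (C : Fin (n₀ + 1) → Set ℂ), IsAdmissible K C ∧
      C 0 = Metric.closedBall c r ∧
      Metric.infEDist c (K \ C 0) = ENNReal.ofReal d ∧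
      geometricLowerBound K C = ENNReal.ofReal (r / d) ∧
      ∀ F : ℂ → ℂ, IsPiecewisePolynomial C F →
        asymptoticConvergenceFactor K F < ENNReal.ofReal (r / d + ε) := by
  have hd : 0 < d := hr.trans hrd
  obtain ⟨q, hq, hq'⟩ : ∃ q, r / d < q ∧ q < min 1 (r / d + ε) :=
    exists_between (lt_min ((div_lt_one hd).2 hrd) (by linarith))
  obtain ⟨hq1, hqε⟩ := lt_min_iff.1 hq'
  have hq0 : 0 < q := (div_pos hr hd).trans hq
  -- A second intermediate rate absorbs the multiplicative constant and keeps the final inequality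
  -- strict.
  obtain ⟨q₁, hqq₁, hq₁ε⟩ := exists_between hqε
  have hv : Function.Injective fun j : Fin n₀ => ((d * (j + 1) : ℝ) : ℂ) := by
    intro i j hij
    have h1 : d * ((i : ℕ) + 1) = d * ((j : ℕ) + 1) := Complex.ofReal_injective hij
    have h2 := add_right_cancel (mul_left_cancel₀ hd.ne' h1)
    exact Fin.ext (by exact_mod_cast h2)
  obtain ⟨e, he, δ, hδ, h, hh⟩ := exists_separating_polynomials _ hv hr hrd (fun j => by
    have : (0 : ℝ) ≤ (j : ℕ) := Nat.cast_nonneg _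
    rw [Complex.norm_real, Real.norm_of_nonneg (by positivity)]
    nlinarith) hq hq1
  -- The cap `d / 2` keeps consecutive segments disjoint.
  have hδ' : 0 < min δ (d / 2) := lt_min hδ (by positivity)
  have hδd : min δ (d / 2) < d := (min_le_right _ _).trans_lt (by linarith)
  have hadm := isAdmissible_discAndSegments (n₀ := n₀) (c := c) hr hrd hδ' hδd
  refine ⟨_, discAndSegments n₀ c r d (min δ (d / 2)), hadm, rfl,
    infEDist_center_discAndSegments hn₀ hr hrd hδ',
    geometricLowerBound_discAndSegments hn₀ hr hrd hδ', fun F hF => ?_⟩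
  obtain ⟨B, hB⟩ := exists_polyDist_le hq0 hq1.le he (fun m hm j => (hh m hm j).1)
    (fun m hm j => (hh m hm j).2.1)
    (fun m hm i j z hz => (hh m hm j).2.2 i z (hz.trans (min_le_left _ _))) hadm.isCompact hF
  exact (asymptoticConvergenceFactor_le hq0.le hqq₁ hB).trans_lt
    ((ENNReal.ofReal_lt_ofReal_iff (by positivity)).2 hq₁ε)

theorem mainTheorem10 (n₀ : ℕ) (hn₀ : 1 ≤ n₀) :
    (∀ (K : Set ℂ) (C : Fin (n₀ + 1) → Set ℂ), IsAdmissible K C →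
      ∀ F : ℂ → ℂ, IsPiecewisePolynomial C F →
        geometricLowerBound K C ≤ asymptoticConvergenceFactor K F) ∧
    (∀ (c : ℂ) (r d ε : ℝ), 0 < r → r < d → 0 < ε →
      ∃ (K : Set ℂ) (C : Fin (n₀ + 1) → Set ℂ), IsAdmissible K C ∧
        C 0 = Metric.closedBall c r ∧
        Metric.infEDist c (K \ C 0) = ENNReal.ofReal d ∧
        geometricLowerBound K C = ENNReal.ofReal (r / d) ∧
        ∀ F : ℂ → ℂ, IsPiecewisePolynomial C F →
          asymptoticConvergenceFactor K F < ENNReal.ofReal (r / d + ε)) :=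
  ⟨fun _ _ hK _ hF => geometricLowerBound_le hK hF,
    fun c _ _ _ hr hrd hε => exists_isAdmissible_asymptoticConvergenceFactor_lt hn₀ c hr hrd hε⟩
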